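/- A group $\Gamma$ is called sofic if for every real $0<\varepsilon<1$ and every finite subset $F\subseteq\Gamma$ there are an integer $n\ge 1$ and a map $\varphi:\Gamma\to S_n$ into the group of permutations of $n$ elements such that (a) $\varphi(e)\varphi(f)\varphi(ef)^{-1}$ has at least $(1-\varepsilon)n$ fixed points for all $e,f\in F$; (b) $\varphi(1)=1$; (c) $\varphi(e)$ has at most $\varepsilon n$ fixed points for every $e\in F$ with $e\neq 1$. For $d\ge 0$ let a matrix $\Delta=(\Delta_{ij})\in \mathrm{Mat}_{d\times d}(\mathbb Z\Gamma)$ act on the complex Hilbert space $\ell^2(\Gamma)^d$ by left convolution, $(\Delta f)_i=\sum_j \Delta_{ij}f_j$, where $(\gamma h)(x)=h(\gamma^{-1}x)$ for $\gamma,x\in\Gamma$ and $h\in\ell^2(\Gamma)$. For a bounded operator $T$ on $\ell^2(\Gamma)^d$ put $\mathrm{Tr}_\Gamma(T)=\sum_{i=1}^d\langle T(\delta_1 e_i),\delta_1 e_i\rangle$, where $\delta_1e_i$ is the vector with $i$-th component the indicator function of $1\in\Gamma$ and all other components $0$. If $\Delta$ is a positive self-adjoint operator, let $F_\Delta(\lambda)=\mathrm{Tr}_\Gamma\,\chi_{[0,\lambda]}(\Delta)$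 for $\lambda\ge 0$ be its spectral density function (with $F_\Delta(\lambda)=0$ for $\lambda<0$), and define the logarithm of its Fuglede–Kadison determinant by $$\ln\det\nolimits_{\mathcal N}(\Delta)=\int_{0^+}^\infty \ln(\lambda)\,dF_\Delta(\lambda)$$ if this Lebesgue–Stieltjes integral over $(0,\infty)$ converges, and $\ln\det_{\mathcal N}(\Delta)=-\infty$ otherwise. **Theorem.** Let $\Gamma$ be a sofic group. Then the Determinant Conjecture holds for $\Gamma$: for every $d$ and every $\Delta\in\mathrm{Mat}_{d\times d}(\mathbb Z\Gamma)$ that is a positive self-adjoint operator on $\ell^2(\Gamma)^d$, one has $\ln\det_{\mathcal N}(\Delta)\ge 0$. In particular the integral converges. -/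

import Mathlib

open MeasureTheory
open scoped ENNReal InnerProductSpace

noncomputable section

namespace SoficDet

/-- A group `Γ` is sofic if for every `0 < ε < 1` and every finite `F ⊆ Γ` there are `n ≥ 1` and a
map `φ : Γ → Sₙ` with `φ 1 = 1` such that `φ e * φ f * (φ (e * f))⁻¹` has at least `(1 - ε) n` fixed
points for all `e, f ∈ F`, and `φ e` has at most `ε n` fixed points for all `1 ≠ e ∈ F`. -/
def IsSofic (Γ : Type*) [Group Γ] : Prop :=
  ∀ ε : ℝ, 0 < ε → ε < 1 → ∀ F : Finset Γ, ∃ n : ℕ, 1 ≤ n ∧ ∃ φ : Γ → Equiv.Perm (Fin n),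
    (∀ e ∈ F, ∀ f ∈ F, (1 - ε) * (n : ℝ) ≤
      ((Finset.univ.filter fun x : Fin n => (φ e * φ f * (φ (e * f))⁻¹) x = x).card : ℝ)) ∧
    φ 1 = 1 ∧
    (∀ e ∈ F, e ≠ 1 →
      ((Finset.univ.filter fun x : Fin n => φ e x = x).card : ℝ) ≤ ε * (n : ℝ))

/-- The Hilbert space `ℓ²(Γ)` of square summable complex functions on `Γ`. -/
abbrev L2 (Γ : Type*) : Type _ := lp (fun _ : Γ => ℂ) 2

/-- The Hilbert space `ℓ²(Γ)^d`. -/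
abbrev L2Vec (Γ : Type*) (d : ℕ) : Type _ := PiLp 2 (fun _ : Fin d => L2 Γ)

theorem memℓp_comp_equiv {Γ : Type*} (σ : Γ ≃ Γ) (f : L2 Γ) :
    Memℓp (fun x => f (σ x)) 2 := by
  have h : (0 : ℝ) < (2 : ℝ≥0∞).toReal := by norm_num
  rw [memℓp_gen_iff h]
  exact (σ.summable_iff (f := fun x => ‖f x‖ ^ (2 : ℝ≥0∞).toReal)).2
    ((memℓp_gen_iff h).1 (lp.memℓp f))

/-- Left translation `(leftTranslation γ f) x = f (γ⁻¹ x)` on `ℓ²(Γ)`. -/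
def leftTranslation {Γ : Type*} [Group Γ] (γ : Γ) : L2 Γ →L[ℂ] L2 Γ :=
  LinearIsometry.toContinuousLinearMap
    { toFun := fun f => ⟨fun x => f (γ⁻¹ * x), memℓp_comp_equiv (Equiv.mulLeft γ⁻¹) f⟩
      map_add' := fun _ _ => rfl
      map_smul' := fun _ _ => rfl
      norm_map' := fun f => by
        have h : (0 : ℝ) < (2 : ℝ≥0∞).toReal := by norm_num
        rw [lp.norm_eq_tsum_rpow h, lp.norm_eq_tsum_rpow h]
        congr 1
        exact (Equiv.mulLeft γ⁻¹).tsum_eq (fun x => ‖f x‖ ^ (2 : ℝ≥0∞).toReal) }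

@[simp] theorem leftTranslation_apply {Γ : Type*} [Group Γ] (γ : Γ) (f : L2 Γ) (x : Γ) :
    leftTranslation γ f x = f (γ⁻¹ * x) := rfl

/-- The left regular representation of `Γ` on `ℓ²(Γ)`. -/
def leftRegular (Γ : Type*) [Group Γ] : Γ →* (L2 Γ →L[ℂ] L2 Γ) where
  toFun := leftTranslation
  map_one' := by
    ext f x
    simp
  map_mul' γ δ := by
    ext f x
    simp [mul_assoc]

/-- The action of the integral group ring `ℤΓ` on `ℓ²(Γ)` by left convolution. -/
def groupRingOp (Γ : Type*) [Group Γ] : MonoidAlgebra ℤ Γ →ₐ[ℤ] (L2 Γ →L[ℂ] L2 Γ) :=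
  MonoidAlgebra.lift ℤ (L2 Γ →L[ℂ] L2 Γ) Γ (leftRegular Γ)

/-- The operator on `ℓ²(Γ)^d` given by a matrix over `ℤΓ`: `(A f) i = ∑ j, A i j * f j`. -/
def matrixOp {Γ : Type*} [Group Γ] {d : ℕ} (A : Matrix (Fin d) (Fin d) (MonoidAlgebra ℤ Γ)) :
    L2Vec Γ d →L[ℂ] L2Vec Γ d :=
  (PiLp.continuousLinearEquiv 2 ℂ (fun _ : Fin d => L2 Γ)).symm.toContinuousLinearMap ∘L
    ContinuousLinearMap.pi fun i =>
      ∑ j, groupRingOp Γ (A i j) ∘L PiLp.proj 2 (fun _ : Fin d => L2 Γ) j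

theorem matrixOp_apply {Γ : Type*} [Group Γ] {d : ℕ}
    (A : Matrix (Fin d) (Fin d) (MonoidAlgebra ℤ Γ)) (f : L2Vec Γ d) (i : Fin d) :
    matrixOp A f i = ∑ j, groupRingOp Γ (A i j) (f j) := by
  simp [matrixOp]

open Classical in
/-- The vector `δ₁ eᵢ` of `ℓ²(Γ)^d`: the indicator function of `1 ∈ Γ` in the `i`-th summand. -/
def basisVec (Γ : Type*) [Group Γ] {d : ℕ} (i : Fin d) : L2Vec Γ d :=
  PiLp.single 2 i (lp.single 2 (1 : Γ) (1 : ℂ))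

/-- The von Neumann trace `∑ i, ⟨T (δ₁ eᵢ), δ₁ eᵢ⟩` (the inner product of Mathlib is linear in its
second variable). On `Mat_d(NΓ)` this is `∑ i, Tr_Γ (T i i)`. -/
def vnTrace {Γ : Type*} [Group Γ] {d : ℕ} (T : L2Vec Γ d →L[ℂ] L2Vec Γ d) : ℂ :=
  ∑ i : Fin d, ⟪basisVec Γ i, T (basisVec Γ i)⟫_ℂ

/-- For a bounded self-adjoint operator `T`, the kernel of `(T - t)₊`; this is the range of the
spectral projection of `T` for the half-line `(-∞, t]`. -/
def spectralSubspace {H : Type*} [NormedAddCommGroup H] [InnerProductSpace ℂ H] [CompleteSpace H]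
    (T : H →L[ℂ] H) (t : ℝ) : Submodule ℂ H :=
  LinearMap.ker (cfc (fun x : ℝ => max (x - t) 0) T : H →L[ℂ] H).toLinearMap

instance {H : Type*} [NormedAddCommGroup H] [InnerProductSpace ℂ H] [CompleteSpace H]
    (T : H →L[ℂ] H) (t : ℝ) : (spectralSubspace T t).HasOrthogonalProjection := by
  have : CompleteSpace (spectralSubspace T t) :=
    (cfc (fun x : ℝ => max (x - t) 0) T : H →L[ℂ] H).isClosed_ker.completeSpace_coe
  infer_instance

/-- The spectral projection `χ_(-∞, t](T)` of a bounded self-adjoint operator `T`. For `T ≥ 0` and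
`t ≥ 0` this is `χ_[0, t](T)`, and for `T ≥ 0` and `t < 0` it is `0`. -/
def spectralProj {H : Type*} [NormedAddCommGroup H] [InnerProductSpace ℂ H] [CompleteSpace H]
    (T : H →L[ℂ] H) (t : ℝ) : H →L[ℂ] H :=
  (spectralSubspace T t).starProjection

/-- The spectral density function `F_T(t) = Tr_Γ χ_[0, t](T)` of a positive operator `T`. -/
def spectralDensity {Γ : Type*} [Group Γ] {d : ℕ} (T : L2Vec Γ d →L[ℂ] L2Vec Γ d) (t : ℝ) : ℝ :=
  (vnTrace (spectralProj T t)).re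

theorem spectralSubspace_mono {H : Type*} [NormedAddCommGroup H] [InnerProductSpace ℂ H]
    [CompleteSpace H] (T : H →L[ℂ] H) : Monotone (spectralSubspace T) := by
  intro s t hst x hx
  by_cases hT : IsSelfAdjoint T
  · have h1 : (cfc (fun x : ℝ => max (x - s) 0) T : H →L[ℂ] H) x = 0 := hx
    have hle : (cfc (fun x : ℝ => max (x - t) 0) T : H →L[ℂ] H) ≤
        cfc (fun x : ℝ => max (x - s) 0) T :=
      cfc_mono (fun y _ => max_le_max (by linarith) le_rfl)
    have hnn : (0 : H →L[ℂ] H) ≤ cfc (fun x : ℝ => max (x - t) 0) T :=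
      cfc_nonneg (fun y _ => le_max_right _ _)
    set g : H →L[ℂ] H := cfc (fun x : ℝ => max (x - t) 0) T with hg
    set r : H →L[ℂ] H := CFC.sqrt g with hr
    have hrr : r * r = g := CFC.sqrt_mul_sqrt_self g hnn
    have hrsa : IsSelfAdjoint r := (CFC.sqrt_nonneg g).isSelfAdjoint
    have h2 := ((ContinuousLinearMap.le_def _ _).1 hle).re_inner_nonneg_left x
    rw [sub_apply, h1, zero_sub, inner_neg_left, map_neg] at h2
    have h3 : RCLike.re ⟪g x, x⟫_ℂ = ‖r x‖ ^ 2 := by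
      rw [← hrr, mul_apply_eq_comp,
        ← ContinuousLinearMap.adjoint_inner_right, hrsa.adjoint_eq, inner_self_eq_norm_sq]
    have h4 : r x = 0 := by
      have : ‖r x‖ ^ 2 ≤ 0 := by rw [← h3]; linarith
      exact norm_eq_zero.1 (pow_eq_zero_iff two_ne_zero |>.1 (le_antisymm this (sq_nonneg _)))
    change g x = 0
    rw [← hrr, mul_apply_eq_comp, h4, map_zero]
  · change (cfc (fun x : ℝ => max (x - t) 0) T : H →L[ℂ] H) x = 0
    rw [cfc_apply_of_not_predicate T hT]
    rfl

theorem spectralDensity_mono {Γ : Type*} [Group Γ] {d : ℕ} (T : L2Vec Γ d →L[ℂ] L2Vec Γ d) :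
    Monotone (spectralDensity T) := by
  intro s t hst
  unfold spectralDensity vnTrace
  rw [Complex.re_sum, Complex.re_sum]
  refine Finset.sum_le_sum fun i _ => ?_
  have h : spectralProj T s ≤ spectralProj T t :=
    Submodule.starProjection_le_starProjection_iff.2 (spectralSubspace_mono T hst)
  have h2 := ((ContinuousLinearMap.le_def _ _).1 h).re_inner_nonneg_right (basisVec Γ i)
  rw [sub_apply, inner_sub_right, map_sub] at h2
  exact sub_nonneg.1 h2

/-- The Lebesgue–Stieltjes measure `dF_T` of the spectral density function. -/
def spectralMeasure {Γ : Type*} [Group Γ] {d : ℕ} (T : L2Vec Γ d →L[ℂ] L2Vec Γ d) : Measure ℝ :=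
  (spectralDensity_mono T).stieltjesFunction.measure

open Classical in
/-- The logarithm of the Fuglede–Kadison determinant of a positive operator `T`: the integral of
`ln` over `(0, ∞)` with respect to `dF_T` if it converges, and `-∞` otherwise. -/
def lnDet {Γ : Type*} [Group Γ] {d : ℕ} (T : L2Vec Γ d →L[ℂ] L2Vec Γ d) : EReal :=
  if IntegrableOn Real.log (Set.Ioi 0) (spectralMeasure T) then
    ((∫ t in Set.Ioi (0 : ℝ), Real.log t ∂(spectralMeasure T) : ℝ) : EReal)
  else ⊥

end SoficDet

end

/-!
The Determinant Conjecture for sofic groups is proved by approximating the positive operator `T`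
given by a matrix `Δ` over `ℤΓ` by positive semidefinite integer matrices, for which it is
elementary: the product of the nonzero eigenvalues of such a matrix is, up to sign, the lowest
nonzero coefficient of an integral characteristic polynomial, so the logarithms of its nonzero
eigenvalues add up to a nonnegative number (`sum_log_eigenvalues_nonneg`). With the convention
`Real.log 0 = 0` the eigenvalue `0` needs no separate treatment.

To avoid maps that are only approximately multiplicative, everything is lifted to the free group on
the set `Γ`. A sofic approximation of `Γ` extends to an honest permutation representation of the
free group, in which the proportion of fixed points of a word tends to `1` or `0` according to
whether the word is trivial in `Γ` (`IsSofic.exists_perm_hom`). Let `Y = A* A`, where `A` lifts `Δ`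
to the group ring of the free group. Then `Y` maps to an operator equal to `T²` over `Γ`, because
`T` is self-adjoint, and to a matrix `Eᵀ E` over `ℤ` in each permutation representation. The traces
of the powers of both are linear in the coefficients of `Y ^ m`, so the normalized moments of the
matrices converge to the moments of `T²`. The row sums of `Eᵀ E` are bounded by the sum `K` of the
absolute values of the coefficients of `Y`. Hence each real polynomial `p` that dominates the
logarithm on `[0, K]` satisfies `Tr p(T²) ≥ 0` (`sum_vnTrace_nonneg`).

The Lebesgue–Stieltjes measure of the spectral density function is identified with the measure that
represents the functional `f ↦ Tr f(T)` (`spectralMeasure_spec`). By the Weierstrass theorem the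
inequality extends from polynomials to continuous functions, in particular to a sequence of
functions with limit `Real.log` on `[0, ∞)` that dominate it and are uniformly bounded above on
`[0, K]` (`logApprox`). Fatou's lemma then gives both the integrability of the logarithm and the
sign of its integral (`integrable_log_of_polynomial`). No estimate of the spectral density near `0`
is needed.
-/

noncomputable section

namespace SoficDet

/-! ### Sofic approximations of words -/

/-- The canonical projection from the free group on the underlying set of `Γ` onto `Γ`. -/
def wordProj (Γ : Type*) [Group Γ] : FreeGroup Γ →* Γ := FreeGroup.lift id

/-- The number of points at which two permutations differ. -/
def disagreement {n : ℕ} (σ τ : Equiv.Perm (Fin n)) : ℕ :=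
  (Finset.univ.filter fun x : Fin n => σ x ≠ τ x).card

theorem disagreement_triangle {n : ℕ} (σ τ ρ : Equiv.Perm (Fin n)) :
    disagreement σ ρ ≤ disagreement σ τ + disagreement τ ρ := by
  unfold disagreement
  refine (Finset.card_le_card ?_).trans (Finset.card_union_le _ _)
  intro x hx
  simp only [Finset.mem_filter, Finset.mem_univ, true_and, Finset.mem_union] at hx ⊢
  by_contra! h
  exact hx (h.1.trans h.2)

theorem disagreement_mul_left {n : ℕ} (ρ σ τ : Equiv.Perm (Fin n)) :
    disagreement (ρ * σ) (ρ * τ) = disagreement σ τ := by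
  simp [disagreement]

theorem disagreement_mul_right {n : ℕ} (ρ σ τ : Equiv.Perm (Fin n)) :
    disagreement (σ * ρ) (τ * ρ) = disagreement σ τ := by
  unfold disagreement
  refine Finset.card_equiv ρ fun x => ?_
  rw [Finset.mem_filter_univ, Finset.mem_filter_univ, Equiv.Perm.mul_apply, Equiv.Perm.mul_apply]

theorem disagreement_comm {n : ℕ} (σ τ : Equiv.Perm (Fin n)) :
    disagreement σ τ = disagreement τ σ := by
  simp [disagreement, ne_comm]

theorem disagreement_mul_mul_le {n : ℕ} (σ τ σ' τ' : Equiv.Perm (Fin n)) :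
    disagreement (σ * τ) (σ' * τ') ≤ disagreement σ σ' + disagreement τ τ' := by
  refine (disagreement_triangle _ (σ * τ') _).trans ?_
  rw [disagreement_mul_left, disagreement_mul_right, add_comm]

theorem card_fixed_add_disagreement {n : ℕ} (σ τ : Equiv.Perm (Fin n)) :
    (Finset.univ.filter fun x : Fin n => (σ * τ⁻¹) x = x).card + disagreement σ τ = n := by
  rw [← disagreement_mul_right τ⁻¹ σ τ, mul_inv_cancel, disagreement]
  have h := Finset.card_filter_add_card_filter_not (s := (Finset.univ : Finset (Fin n)))
    (fun x => (σ * τ⁻¹) x = x)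
  rw [Finset.card_univ, Fintype.card_fin] at h
  convert h using 3
  exact Finset.filter_congr fun _ _ => Iff.rfl

/-- If `φ` is multiplicative up to a proportion `ε` of the points on a large enough finite set,
then on a given word the homomorphism extending `φ` agrees with `φ` of the value of the word, up to
a proportion `O(ε)` of the points. -/
theorem exists_disagreement_word_le {Γ : Type*} [Group Γ] (w : FreeGroup Γ) :
    ∃ C : ℝ, 0 ≤ C ∧ ∃ S : Finset Γ, ∀ (n : ℕ) (φ : Γ → Equiv.Perm (Fin n)) (ε : ℝ), φ 1 = 1 →
      (∀ e ∈ S, ∀ f ∈ S, (disagreement (φ e * φ f) (φ (e * f)) : ℝ) ≤ ε * n) →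
      (disagreement (FreeGroup.lift φ w) (φ (wordProj Γ w)) : ℝ) ≤ C * (ε * n) := by
  classical
  induction w using FreeGroup.induction_on with
  | C1 => exact ⟨0, le_rfl, ∅, fun n φ ε h1 _ => by simp [h1, disagreement]⟩
  | of g => exact ⟨0, le_rfl, ∅, fun n φ ε h1 _ => by simp [wordProj, disagreement]⟩
  | inv_of g _ =>
    refine ⟨1, zero_le_one, {g, g⁻¹}, fun n φ ε h1 h => ?_⟩
    have := h g (by simp) g⁻¹ (by simp)
    rw [mul_inv_cancel, h1, ← disagreement_mul_left (φ g)⁻¹, disagreement_comm] at this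
    simpa [wordProj] using this
  | mul a b iha ihb =>
    obtain ⟨Ca, ha0, Sa, ha⟩ := iha
    obtain ⟨Cb, hb0, Sb, hb⟩ := ihb
    refine ⟨Ca + Cb + 1, by positivity, Sa ∪ Sb ∪ {wordProj Γ a, wordProj Γ b},
      fun n φ ε h1 h => ?_⟩
    have h2 := ha n φ ε h1 fun e he f hf => h e (by simp [he]) f (by simp [hf])
    have h3 := hb n φ ε h1 fun e he f hf => h e (by simp [he]) f (by simp [hf])
    have h4 := h (wordProj Γ a) (by simp) (wordProj Γ b) (by simp)
    have h5 : (disagreement (FreeGroup.lift φ (a * b)) (φ (wordProj Γ (a * b))) : ℝ) ≤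
        disagreement (FreeGroup.lift φ a) (φ (wordProj Γ a)) +
          disagreement (FreeGroup.lift φ b) (φ (wordProj Γ b)) +
          disagreement (φ (wordProj Γ a) * φ (wordProj Γ b)) (φ (wordProj Γ a * wordProj Γ b)) := by
      rw [map_mul, map_mul]
      exact_mod_cast (disagreement_triangle _ _ _).trans
        (Nat.add_le_add_right (disagreement_mul_mul_le _ _ _ _) _)
    linarith

/-- The number of fixed points of a permutation. -/
def fixCard {n : ℕ} (σ : Equiv.Perm (Fin n)) : ℕ :=
  (Finset.univ.filter fun x : Fin n => σ x = x).card

theorem fixCard_add_disagreement_one {n : ℕ} (σ : Equiv.Perm (Fin n)) :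
    fixCard σ + disagreement σ 1 = n := by
  simpa [fixCard] using card_fixed_add_disagreement σ 1

open Classical in
/-- A sofic group is the limit, in the sense of traces, of finite permutation actions of the free
group on its elements: the proportion of fixed points of a word tends to `1` or `0` according to
whether the word is trivial in `Γ` or not. -/
theorem IsSofic.exists_perm_hom {Γ : Type*} [Group Γ] (hΓ : IsSofic Γ) (W : Finset (FreeGroup Γ))
    {η : ℝ} (hη : 0 < η) : ∃ n : ℕ, 1 ≤ n ∧ ∃ ψ : FreeGroup Γ →* Equiv.Perm (Fin n),
      ∀ w ∈ W, |(fixCard (ψ w) : ℝ) - (if wordProj Γ w = 1 then (n : ℝ) else 0)| ≤ η * n := by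
  choose C hC0 S hS using fun w : FreeGroup Γ => exists_disagreement_word_le w
  set D : ℝ := ∑ w ∈ W, C w with hD
  have hD0 : 0 ≤ D := Finset.sum_nonneg fun w _ => hC0 w
  have hCD : ∀ w ∈ W, C w ≤ D := fun w hw =>
    Finset.single_le_sum (f := C) (fun w _ => hC0 w) hw
  set ε : ℝ := min (1 / 2) (η / (D + 1)) with hε
  have hε0 : 0 < ε := by positivity
  have hε1 : ε < 1 := (min_le_left _ _).trans_lt (by norm_num)
  have hεη : (D + 1) * ε ≤ η := by
    have := min_le_right (1 / 2) (η / (D + 1))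
    rwa [le_div_iff₀ (by positivity), mul_comm] at this
  obtain ⟨n, hn, φ, hφ, hφ1, hfix⟩ := hΓ ε hε0 hε1 (W.biUnion S ∪ W.image (wordProj Γ))
  refine ⟨n, hn, FreeGroup.lift φ, fun w hw => ?_⟩
  have hn0 : (0 : ℝ) ≤ n := n.cast_nonneg
  have h1 : (disagreement (FreeGroup.lift φ w) (φ (wordProj Γ w)) : ℝ) ≤ C w * (ε * n) := by
    refine hS w n φ ε hφ1 fun e he f hf => ?_
    have h2 := hφ e (Finset.mem_union_left _ (Finset.mem_biUnion.2 ⟨w, hw, he⟩))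
      f (Finset.mem_union_left _ (Finset.mem_biUnion.2 ⟨w, hw, hf⟩))
    have h3 : ((Finset.univ.filter fun x : Fin n => (φ e * φ f * (φ (e * f))⁻¹) x = x).card : ℝ) +
        disagreement (φ e * φ f) (φ (e * f)) = n := by
      exact_mod_cast card_fixed_add_disagreement (φ e * φ f) (φ (e * f))
    linarith
  have h2 : (disagreement (FreeGroup.lift φ w) (φ (wordProj Γ w)) : ℝ) ≤ D * (ε * n) :=
    h1.trans (mul_le_mul_of_nonneg_right (hCD w hw) (by positivity))
  have h3 : (fixCard (FreeGroup.lift φ w) : ℝ) + disagreement (FreeGroup.lift φ w) 1 = n := by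
    exact_mod_cast fixCard_add_disagreement_one _
  have h4 : (D + 1) * (ε * n) ≤ η * n := by
    rw [← mul_assoc]
    exact mul_le_mul_of_nonneg_right hεη hn0
  have h5 : 0 ≤ ε * n := by positivity
  split_ifs with hw1
  · rw [hw1, hφ1] at h2
    rw [abs_sub_comm, abs_of_nonneg] <;>
    nlinarith [(disagreement (FreeGroup.lift φ w) 1).cast_nonneg (α := ℝ)]
  · have h6 := hfix (wordProj Γ w)
      (Finset.mem_union_right _ (Finset.mem_image_of_mem _ hw)) hw1
    have h7 : (fixCard (φ (wordProj Γ w)) : ℝ) + disagreement (φ (wordProj Γ w)) 1 = n := by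
      exact_mod_cast fixCard_add_disagreement_one _
    have h8 : (disagreement (φ (wordProj Γ w)) 1 : ℝ) ≤
        disagreement (FreeGroup.lift φ w) (φ (wordProj Γ w)) +
          disagreement (FreeGroup.lift φ w) 1 := by
      rw [disagreement_comm (FreeGroup.lift φ w) (φ (wordProj Γ w))]
      exact_mod_cast disagreement_triangle _ _ _
    change (fixCard (φ (wordProj Γ w)) : ℝ) ≤ ε * n at h6
    rw [sub_zero, abs_of_nonneg (Nat.cast_nonneg _)]
    linarith

/-! ### Matrices over group rings and their operators -/

/-- The conjugate transpose of a matrix over an integral group ring, for the involution of the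
group ring that sends group elements to their inverses. -/
def starMatrix {G : Type*} [Group G] {d : ℕ} (A : Matrix (Fin d) (Fin d) (MonoidAlgebra ℤ G)) :
    Matrix (Fin d) (Fin d) (MonoidAlgebra ℤ G) :=
  Matrix.of fun i j => MonoidAlgebra.mapDomain (fun g : G => g⁻¹) (A j i)

theorem adjoint_leftTranslation {Γ : Type*} [Group Γ] (γ : Γ) :
    ContinuousLinearMap.adjoint (leftTranslation γ) = leftTranslation γ⁻¹ := by
  refine ((ContinuousLinearMap.eq_adjoint_iff _ _).2 fun f g => ?_).symm
  rw [lp.inner_eq_tsum, lp.inner_eq_tsum]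
  rw [← (Equiv.mulLeft γ).tsum_eq fun x => ⟪f x, leftTranslation γ g x⟫_ℂ]
  simp

theorem adjoint_groupRingOp {Γ : Type*} [Group Γ] (a : MonoidAlgebra ℤ Γ) :
    ContinuousLinearMap.adjoint (groupRingOp Γ a) =
      groupRingOp Γ (MonoidAlgebra.mapDomain (fun g : Γ => g⁻¹) a) := by
  induction a using MonoidAlgebra.induction_linear with
  | zero => simp
  | add a b ha hb => rw [map_add, map_add, ha, hb, MonoidAlgebra.mapDomain_add, map_add]
  | single g c =>
    have h := adjoint_leftTranslation g
    simp only [groupRingOp, MonoidAlgebra.lift_single, MonoidAlgebra.mapDomain_single]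
    change ContinuousLinearMap.adjoint (c • leftTranslation g) = c • leftTranslation g⁻¹
    rw [← h]
    exact map_zsmul ContinuousLinearMap.adjoint c (leftTranslation g)

theorem adjoint_matrixOp {Γ : Type*} [Group Γ] {d : ℕ}
    (A : Matrix (Fin d) (Fin d) (MonoidAlgebra ℤ Γ)) :
    ContinuousLinearMap.adjoint (matrixOp A) = matrixOp (starMatrix A) := by
  refine ((ContinuousLinearMap.eq_adjoint_iff _ _).2 fun f g => ?_).symm
  simp only [PiLp.inner_apply, matrixOp_apply, sum_inner, inner_sum]
  rw [Finset.sum_comm]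
  refine Finset.sum_congr rfl fun i _ => Finset.sum_congr rfl fun j _ => ?_
  rw [starMatrix, Matrix.of_apply, ← adjoint_groupRingOp,
    ContinuousLinearMap.adjoint_inner_left]

theorem matrixOp_mul {Γ : Type*} [Group Γ] {d : ℕ}
    (A B : Matrix (Fin d) (Fin d) (MonoidAlgebra ℤ Γ)) :
    matrixOp (A * B) = matrixOp A * matrixOp B := by
  ext1 f
  ext1 i
  simp only [mul_apply_eq_comp, matrixOp_apply, Matrix.mul_apply, map_sum, map_mul,
    sum_apply]
  rw [Finset.sum_comm]

theorem matrixOp_one {Γ : Type*} [Group Γ] {d : ℕ} :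
    matrixOp (1 : Matrix (Fin d) (Fin d) (MonoidAlgebra ℤ Γ)) = 1 := by
  ext1 f
  ext1 i
  rw [matrixOp_apply, Finset.sum_eq_single i]
  · simp
  · intro j _ hj
    simp [Matrix.one_apply_ne' hj]
  · simp

theorem matrixOp_pow {Γ : Type*} [Group Γ] {d : ℕ}
    (A : Matrix (Fin d) (Fin d) (MonoidAlgebra ℤ Γ)) (m : ℕ) :
    matrixOp (A ^ m) = matrixOp A ^ m := by
  induction m with
  | zero => rw [pow_zero, pow_zero, matrixOp_one]
  | succ m ih => rw [pow_succ, pow_succ, matrixOp_mul, ih]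

open Classical in
theorem inner_single_groupRingOp {Γ : Type*} [Group Γ] (a : MonoidAlgebra ℤ Γ) :
    ⟪(lp.single 2 (1 : Γ) (1 : ℂ) : L2 Γ), groupRingOp Γ a (lp.single 2 (1 : Γ) (1 : ℂ))⟫_ℂ =
      (a.coeff 1 : ℂ) := by
  induction a using MonoidAlgebra.induction_linear with
  | zero => simp
  | add a b ha hb => rw [map_add, add_apply, inner_add_right, ha, hb]; simp
  | single g c =>
    rw [groupRingOp, MonoidAlgebra.lift_single, lp.inner_single_left]
    change ⟪(1 : ℂ), ((c • leftTranslation g) (lp.single 2 (1 : Γ) (1 : ℂ)) : L2 Γ) 1⟫_ℂ = _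
    rw [smul_apply, ← Int.cast_smul_eq_zsmul ℂ, lp.coeFn_smul, Pi.smul_apply,
      leftTranslation_apply]
    by_cases hg : g = 1
    · subst hg; simp
    · have : g⁻¹ * 1 ≠ 1 := by simpa using hg
      simp [lp.single_apply, hg, MonoidAlgebra.coeff_single]

theorem vnTrace_matrixOp {Γ : Type*} [Group Γ] {d : ℕ}
    (A : Matrix (Fin d) (Fin d) (MonoidAlgebra ℤ Γ)) :
    vnTrace (matrixOp A) = ((∑ i, (A i i).coeff 1 : ℤ) : ℂ) := by
  classical
  rw [vnTrace, Int.cast_sum]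
  refine Finset.sum_congr rfl fun i _ => ?_
  rw [PiLp.inner_apply, Finset.sum_eq_single i]
  · rw [matrixOp_apply, Finset.sum_eq_single i]
    · rw [← inner_single_groupRingOp]
      simp [basisVec]
    · intro j _ hj
      simp [basisVec, hj]
    · simp
  · intro j _ hj
    simp [basisVec, hj]
  · simp

/-! ### Lifting to the group ring of the free group -/

/-- The lift of a matrix over `ℤΓ` to the group ring of the free group on the set `Γ`. -/
def wordLift {Γ : Type*} [Group Γ] {d : ℕ} (A : Matrix (Fin d) (Fin d) (MonoidAlgebra ℤ Γ)) :
    Matrix (Fin d) (Fin d) (MonoidAlgebra ℤ (FreeGroup Γ)) :=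
  A.map (MonoidAlgebra.mapDomain FreeGroup.of)

/-- The matrix `A* A` over the group ring of the free group, for the lift of a matrix over `ℤΓ`. -/
def wordGram {Γ : Type*} [Group Γ] {d : ℕ} (A : Matrix (Fin d) (Fin d) (MonoidAlgebra ℤ Γ)) :
    Matrix (Fin d) (Fin d) (MonoidAlgebra ℤ (FreeGroup Γ)) :=
  starMatrix (wordLift A) * wordLift A

theorem map_wordProj_wordGram {Γ : Type*} [Group Γ] {d : ℕ}
    (A : Matrix (Fin d) (Fin d) (MonoidAlgebra ℤ Γ)) :
    (MonoidAlgebra.mapDomainRingHom ℤ (wordProj Γ)).mapMatrix (wordGram A) = starMatrix A * A := by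
  have key : ∀ a : MonoidAlgebra ℤ Γ, MonoidAlgebra.mapDomainRingHom ℤ (wordProj Γ)
      (MonoidAlgebra.mapDomain FreeGroup.of a) = a := by
    intro a
    induction a using MonoidAlgebra.induction_linear with
    | zero => simp
    | add a b ha hb => rw [MonoidAlgebra.mapDomain_add, map_add, ha, hb]
    | single g c => simp [wordProj]
  have key' : ∀ a : MonoidAlgebra ℤ Γ, MonoidAlgebra.mapDomainRingHom ℤ (wordProj Γ)
      (MonoidAlgebra.mapDomain (fun w => w⁻¹) (MonoidAlgebra.mapDomain FreeGroup.of a)) =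
      MonoidAlgebra.mapDomain (fun g => g⁻¹) a := by
    intro a
    induction a using MonoidAlgebra.induction_linear with
    | zero => simp
    | add a b ha hb => rw [MonoidAlgebra.mapDomain_add, MonoidAlgebra.mapDomain_add, map_add,
        ha, hb, MonoidAlgebra.mapDomain_add]
    | single g c => simp [wordProj]
  rw [wordGram, map_mul]
  congr 1
  · ext1 i j
    exact key' _
  · ext1 i j
    exact key _

open Classical in
theorem coeff_map_wordProj_one {Γ : Type*} [Group Γ] (a : MonoidAlgebra ℤ (FreeGroup Γ)) :
    (MonoidAlgebra.mapDomainRingHom ℤ (wordProj Γ) a).coeff 1 =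
      a.coeff.sum fun w c => if wordProj Γ w = 1 then c else 0 := by
  induction a using MonoidAlgebra.induction_linear with
  | zero => simp
  | add a b ha hb =>
    rw [map_add, MonoidAlgebra.coeff_add, Finsupp.add_apply, ha, hb, MonoidAlgebra.coeff_add,
      Finsupp.sum_add_index']
    · simp
    · intro w b c
      split_ifs <;> simp
  | single g c => simp [Finsupp.single_apply]

open Classical in
/-- The even moments of a self-adjoint operator over the group ring, computed on words. -/
theorem vnTrace_matrixOp_pow {Γ : Type*} [Group Γ] {d : ℕ}
    (A : Matrix (Fin d) (Fin d) (MonoidAlgebra ℤ Γ)) (hA : IsSelfAdjoint (matrixOp A)) (m : ℕ) :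
    vnTrace (matrixOp A ^ (2 * m)) = ((∑ i, ((wordGram A ^ m) i i).coeff.sum
      fun w c => if wordProj Γ w = 1 then c else 0 : ℤ) : ℂ) := by
  have h : matrixOp A ^ 2 = matrixOp (starMatrix A * A) := by
    rw [matrixOp_mul, ← adjoint_matrixOp, hA.adjoint_eq, pow_two]
  rw [pow_mul, h, ← map_wordProj_wordGram, ← matrixOp_pow, ← map_pow, vnTrace_matrixOp]
  congr 1
  refine Finset.sum_congr rfl fun i _ => ?_
  rw [← coeff_map_wordProj_one]
  rfl

/-! ### Positive integer matrices -/

theorem trailingCoeff_prod {ι R : Type*} [CommRing R] [IsDomain R] (s : Finset ι)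
    (f : ι → Polynomial R) :
    (∏ i ∈ s, f i).trailingCoeff = ∏ i ∈ s, (f i).trailingCoeff := by
  classical
  induction s using Finset.induction_on with
  | empty => exact (Polynomial.trailingCoeff_eq_coeff_zero (by simp)).trans (by simp)
  | insert a s ha ih => rw [Finset.prod_insert ha, Finset.prod_insert ha,
      Polynomial.trailingCoeff_mul, ih]

theorem log_abs_trailingCoeff_X_sub_C (r : ℝ) :
    Real.log |(Polynomial.X - Polynomial.C r).trailingCoeff| = Real.log r := by
  by_cases hr : r = 0
  · subst hr
    simp [Polynomial.trailingCoeff]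
  · have h : (Polynomial.X - Polynomial.C r).natTrailingDegree = 0 :=
      Polynomial.natTrailingDegree_eq_zero.2 (Or.inr (by simpa using hr))
    simp [Polynomial.trailingCoeff, h]

/-- The product of the nonzero eigenvalues of a symmetric integer matrix is, up to sign, the
lowest nonzero coefficient of its characteristic polynomial, hence at least `1` in absolute value.
Zero eigenvalues do not contribute to the sum, because `Real.log 0 = 0`. -/
theorem sum_log_eigenvalues_nonneg {ι : Type*} [Fintype ι] [DecidableEq ι] (N : Matrix ι ι ℤ)
    (hN : (N.map (Int.cast : ℤ → ℝ)).IsHermitian) :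
    0 ≤ ∑ i, Real.log (hN.eigenvalues i) := by
  have h1 : (N.map (Int.cast : ℤ → ℝ)).charpoly = N.charpoly.map (Int.castRingHom ℝ) :=
    Matrix.charpoly_map N (Int.castRingHom ℝ)
  have h2 : (N.charpoly.map (Int.castRingHom ℝ)).trailingCoeff =
      (N.charpoly.trailingCoeff : ℝ) := by
    have h3 : (N.charpoly.map (Int.castRingHom ℝ)).natTrailingDegree =
        N.charpoly.natTrailingDegree := by
      simp only [Polynomial.natTrailingDegree, Polynomial.trailingDegree,
        Polynomial.support_map_of_injective _ (RingHom.injective_int (Int.castRingHom ℝ))]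
    rw [Polynomial.trailingCoeff, h3, Polynomial.coeff_map]
    rfl
  have h4 : N.charpoly.trailingCoeff ≠ 0 := by
    rw [Ne, Polynomial.trailingCoeff_eq_zero]
    exact (Matrix.charpoly_monic N).ne_zero
  have h5 : (N.charpoly.trailingCoeff : ℝ) =
      ∏ i, (Polynomial.X - Polynomial.C (hN.eigenvalues i)).trailingCoeff := by
    rw [← h2, ← h1, hN.charpoly_eq, trailingCoeff_prod]
    rfl
  have h6 : ∑ i, Real.log (hN.eigenvalues i) = Real.log |(N.charpoly.trailingCoeff : ℝ)| := by
    rw [h5, Finset.abs_prod, Real.log_prod]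
    · simp only [log_abs_trailingCoeff_X_sub_C]
    · intro i _
      rw [abs_ne_zero, Ne, Polynomial.trailingCoeff_eq_zero]
      exact Polynomial.X_sub_C_ne_zero _
  rw [h6]
  refine Real.log_nonneg ?_
  exact_mod_cast Int.one_le_abs h4

theorem trace_pow_eq_sum_eigenvalues {ι : Type*} [Fintype ι] [DecidableEq ι] {A : Matrix ι ι ℝ}
    (hA : A.IsHermitian) (m : ℕ) : (A ^ m).trace = ∑ i, hA.eigenvalues i ^ m := by
  conv_lhs => rw [hA.spectral_theorem, ← map_pow, Unitary.conjStarAlgAut_apply,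
    Matrix.trace_mul_cycle, Unitary.coe_star_mul_self, one_mul, Matrix.diagonal_pow,
    Matrix.trace_diagonal]
  rfl

/-- A consequence of Gershgorin's circle theorem. -/
theorem eigenvalues_le_of_row_sum_le {ι : Type*} [Fintype ι] [DecidableEq ι] {A : Matrix ι ι ℝ}
    (hA : A.IsHermitian) {K : ℝ} (hK : ∀ i, ∑ j, |A i j| ≤ K) (i : ι) :
    hA.eigenvalues i ≤ K := by
  have h : Module.End.HasEigenvalue (Matrix.toLin' A) (hA.eigenvalues i) := by
    rw [Module.End.hasEigenvalue_iff_mem_spectrum, Matrix.spectrum_toLin']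
    exact hA.eigenvalues_mem_spectrum_real i
  obtain ⟨k, hk⟩ := eigenvalue_mem_ball h
  rw [Metric.mem_closedBall, Real.dist_eq] at hk
  have h1 := hK k
  rw [← Finset.add_sum_erase _ _ (Finset.mem_univ k)] at h1
  simp only [Real.norm_eq_abs] at hk
  linarith [le_abs_self (A k k), le_abs_self (hA.eigenvalues i - A k k)]

/-- If a polynomial dominates the logarithm on an interval that contains the spectrum of a positive
integer matrix, then its value at the matrix has nonnegative trace. -/
theorem sum_trace_gram_nonneg {ι : Type*} [Fintype ι] [DecidableEq ι] (E : Matrix ι ι ℤ) {K : ℝ}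
    (hK : ∀ i, ∑ j, |(((E.transpose * E) i j : ℤ) : ℝ)| ≤ K) (p : Polynomial ℝ)
    (hp : ∀ x ∈ Set.Icc 0 K, Real.log x ≤ p.eval x) :
    0 ≤ p.sum fun m c => c * (((E.transpose * E) ^ m).trace : ℤ) := by
  set N : Matrix ι ι ℤ := E.transpose * E with hNdef
  set A : Matrix ι ι ℝ := N.map (Int.cast : ℤ → ℝ) with hAdef
  have hAE : A = (E.map (Int.cast : ℤ → ℝ)).conjTranspose * E.map (Int.cast : ℤ → ℝ) := by
    rw [hAdef, hNdef]
    ext i j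
    simp [Matrix.mul_apply]
  have hpos : A.PosSemidef := hAE ▸ Matrix.posSemidef_conjTranspose_mul_self _
  have hA : A.IsHermitian := hpos.isHermitian
  have htr : ∀ m, (((N ^ m).trace : ℤ) : ℝ) = ∑ i, hA.eigenvalues i ^ m := by
    intro m
    rw [← trace_pow_eq_sum_eigenvalues hA, hAdef]
    have h : (N.map (Int.cast : ℤ → ℝ)) ^ m = (N ^ m).map (Int.cast : ℤ → ℝ) :=
      (map_pow (Int.castRingHom ℝ).mapMatrix N m).symm
    rw [h]
    simp [Matrix.trace]
  calc (0 : ℝ) ≤ ∑ i, Real.log (hA.eigenvalues i) := sum_log_eigenvalues_nonneg N hA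
    _ ≤ ∑ i, p.eval (hA.eigenvalues i) := Finset.sum_le_sum fun i _ => hp _
        ⟨hpos.eigenvalues_nonneg i, eigenvalues_le_of_row_sum_le hA hK i⟩
    _ = p.sum fun m c => c * (((N ^ m).trace : ℤ) : ℝ) := by
        simp only [Polynomial.eval_eq_sum, Polynomial.sum_def, htr, Finset.mul_sum]
        exact Finset.sum_comm

/-! ### Permutation representations of matrices over the group ring -/

/-- The permutation matrix with entry `1` at `(σ y, y)`, as a homomorphism. -/
def permMatrixHom (n : ℕ) : Equiv.Perm (Fin n) →* Matrix (Fin n) (Fin n) ℤ where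
  toFun σ := Matrix.of fun x y => if x = σ y then 1 else 0
  map_one' := by
    ext x y
    rw [Matrix.one_apply]
    rfl
  map_mul' σ τ := by
    ext x y
    rw [Matrix.mul_apply, Finset.sum_eq_single (τ y)]
    · simp only [Matrix.of_apply, if_true, mul_one]
      rfl
    · intro z _ hz
      simp [hz]
    · simp

/-- The integral representation of the group ring given by a permutation representation. -/
def permRep {G : Type*} [Group G] {n : ℕ} (ψ : G →* Equiv.Perm (Fin n)) :
    MonoidAlgebra ℤ G →ₐ[ℤ] Matrix (Fin n) (Fin n) ℤ :=
  MonoidAlgebra.lift ℤ _ G ((permMatrixHom n).comp ψ)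

/-- The block matrix obtained by applying a permutation representation of `G` to the entries of a
matrix over `ℤG`. -/
def blockRep {G : Type*} [Group G] {n : ℕ} (ψ : G →* Equiv.Perm (Fin n)) (d : ℕ) :
    Matrix (Fin d) (Fin d) (MonoidAlgebra ℤ G) →+* Matrix (Fin d × Fin n) (Fin d × Fin n) ℤ :=
  (Matrix.compRingEquiv (Fin d) (Fin n) ℤ).toRingHom.comp (permRep ψ).toRingHom.mapMatrix

theorem blockRep_apply {G : Type*} [Group G] {n d : ℕ} (ψ : G →* Equiv.Perm (Fin n))
    (A : Matrix (Fin d) (Fin d) (MonoidAlgebra ℤ G)) (p q : Fin d × Fin n) :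
    blockRep ψ d A p q = permRep ψ (A p.1 q.1) p.2 q.2 := rfl

theorem permRep_single {G : Type*} [Group G] {n : ℕ} (ψ : G →* Equiv.Perm (Fin n)) (g : G) (c : ℤ)
    (x y : Fin n) :
    permRep ψ (MonoidAlgebra.single g c) x y = if x = ψ g y then c else 0 := by
  simp [permRep, permMatrixHom]

theorem permRep_inv {G : Type*} [Group G] {n : ℕ} (ψ : G →* Equiv.Perm (Fin n))
    (a : MonoidAlgebra ℤ G) :
    permRep ψ (MonoidAlgebra.mapDomain (fun g : G => g⁻¹) a) = (permRep ψ a).transpose := by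
  induction a using MonoidAlgebra.induction_linear with
  | zero => simp
  | add a b ha hb =>
    rw [MonoidAlgebra.mapDomain_add, map_add, ha, hb, map_add, Matrix.transpose_add]
  | single g c =>
    ext x y
    rw [MonoidAlgebra.mapDomain_single, Matrix.transpose_apply, permRep_single, permRep_single,
      map_inv]
    simp only [Equiv.Perm.eq_inv_iff_eq, eq_comm]

theorem blockRep_starMatrix {G : Type*} [Group G] {n d : ℕ} (ψ : G →* Equiv.Perm (Fin n))
    (A : Matrix (Fin d) (Fin d) (MonoidAlgebra ℤ G)) :
    blockRep ψ d (starMatrix A) = (blockRep ψ d A).transpose := by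
  ext p q
  rw [blockRep_apply, Matrix.transpose_apply, blockRep_apply, starMatrix, Matrix.of_apply,
    permRep_inv, Matrix.transpose_apply]

theorem trace_permRep {G : Type*} [Group G] {n : ℕ} (ψ : G →* Equiv.Perm (Fin n))
    (a : MonoidAlgebra ℤ G) :
    (permRep ψ a).trace = a.coeff.sum fun w c => c * (fixCard (ψ w) : ℤ) := by
  induction a using MonoidAlgebra.induction_linear with
  | zero => simp
  | add a b ha hb =>
    rw [map_add, Matrix.trace_add, ha, hb, MonoidAlgebra.coeff_add, Finsupp.sum_add_index']
    · simp
    · intros; ring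
  | single g c =>
    simp only [Matrix.trace, Matrix.diag_apply, permRep_single, MonoidAlgebra.coeff_single,
      fixCard]
    rw [Finsupp.sum_single_index (by simp), ← Finset.sum_filter, Finset.sum_const,
      nsmul_eq_mul, mul_comm]
    simp only [eq_comm]

theorem trace_blockRep {G : Type*} [Group G] {n d : ℕ} (ψ : G →* Equiv.Perm (Fin n))
    (A : Matrix (Fin d) (Fin d) (MonoidAlgebra ℤ G)) :
    (blockRep ψ d A).trace =
      ∑ i, (A i i).coeff.sum fun w c => c * (fixCard (ψ w) : ℤ) := by
  simp only [← trace_permRep, Matrix.trace, Fintype.sum_prod_type, Matrix.diag_apply,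
    blockRep_apply]

theorem sum_abs_permRep_le {G : Type*} [Group G] {n : ℕ} (ψ : G →* Equiv.Perm (Fin n))
    (a : MonoidAlgebra ℤ G) (x : Fin n) :
    ∑ y, |permRep ψ a x y| ≤ ∑ w ∈ a.coeff.support, |a.coeff w| := by
  have h : ∀ y, permRep ψ a x y = ∑ w ∈ a.coeff.support, if x = ψ w y then a.coeff w else 0 := by
    intro y
    rw [permRep, MonoidAlgebra.lift_apply, Finsupp.sum, Matrix.sum_apply]
    simp [permMatrixHom]
  calc ∑ y, |permRep ψ a x y|
      ≤ ∑ y, ∑ w ∈ a.coeff.support, |if x = ψ w y then a.coeff w else 0| :=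
        Finset.sum_le_sum fun y _ => by rw [h y]; exact Finset.abs_sum_le_sum_abs _ _
    _ = ∑ w ∈ a.coeff.support, |a.coeff w| := by
        rw [Finset.sum_comm]
        refine Finset.sum_congr rfl fun w _ => ?_
        rw [Finset.sum_eq_single ((ψ w).symm x)]
        · simp
        · intro y _ hy
          rw [if_neg, abs_zero]
          rintro rfl
          simp at hy
        · simp

/-- The row sums of a block matrix `blockRep ψ d A` are bounded independently of `ψ`. -/
theorem sum_abs_blockRep_le {G : Type*} [Group G] {n d : ℕ} (ψ : G →* Equiv.Perm (Fin n))
    (A : Matrix (Fin d) (Fin d) (MonoidAlgebra ℤ G)) (p : Fin d × Fin n) :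
    ∑ q, |blockRep ψ d A p q| ≤ ∑ i, ∑ j, ∑ w ∈ (A i j).coeff.support, |(A i j).coeff w| := by
  rw [Fintype.sum_prod_type]
  calc ∑ j, ∑ y, |blockRep ψ d A p (j, y)|
      ≤ ∑ j, ∑ w ∈ (A p.1 j).coeff.support, |(A p.1 j).coeff w| :=
        Finset.sum_le_sum fun j _ => sum_abs_permRep_le ψ (A p.1 j) p.2
    _ ≤ _ := Finset.single_le_sum
        (f := fun i => ∑ j, ∑ w ∈ (A i j).coeff.support, |(A i j).coeff w|)
        (fun i _ => Finset.sum_nonneg fun j _ => Finset.sum_nonneg fun w _ => abs_nonneg _)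
        (Finset.mem_univ p.1)

open Filter Topology

/-! ### Spectral projections as strong limits -/

section Hilbert

variable {H : Type*} [NormedAddCommGroup H] [InnerProductSpace ℂ H] [CompleteSpace H]

/-- The functions `x ↦ n (x - t)₊ / (1 + n (x - t)₊)`, which increase to the indicator function
of `(t, ∞)`. -/
def softStep (t : ℝ) (n : ℕ) (x : ℝ) : ℝ := n / (1 + n * max (x - t) 0) * max (x - t) 0

theorem one_add_mul_max_pos (t : ℝ) (n : ℕ) (x : ℝ) : 0 < 1 + n * max (x - t) 0 := by positivity

theorem continuous_softStep (t : ℝ) (n : ℕ) : Continuous (softStep t n) := by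
  unfold softStep
  fun_prop (disch := exact fun x => (one_add_mul_max_pos t n x).ne')

theorem softStep_nonneg (t : ℝ) (n : ℕ) (x : ℝ) : 0 ≤ softStep t n x := by
  unfold softStep; positivity

theorem one_sub_softStep (t : ℝ) (n : ℕ) (x : ℝ) :
    1 - softStep t n x = (1 + n * max (x - t) 0)⁻¹ := by
  have := (one_add_mul_max_pos t n x).ne'
  unfold softStep
  field_simp
  ring

theorem softStep_le_one (t : ℝ) (n : ℕ) (x : ℝ) : softStep t n x ≤ 1 := by
  have := one_sub_softStep t n x
  have h : 0 ≤ (1 + n * max (x - t) 0)⁻¹ := inv_nonneg.2 (one_add_mul_max_pos t n x).le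
  linarith

theorem tendsto_softStep (t x : ℝ) :
    Tendsto (fun n => softStep t n x) atTop (𝓝 ((Set.Ioi t).indicator 1 x)) := by
  by_cases hx : x ∈ Set.Ioi t
  · have hx' : 0 < max (x - t) 0 := lt_max_of_lt_left (sub_pos.2 hx)
    have h : Tendsto (fun n : ℕ => 1 - (1 + n * max (x - t) 0)⁻¹) atTop (𝓝 (1 - 0)) := by
      refine tendsto_const_nhds.sub (tendsto_inv_atTop_zero.comp ?_)
      exact tendsto_atTop_add_const_left _ _
        (tendsto_natCast_atTop_atTop.atTop_mul_const hx')
    simp only [← one_sub_softStep, sub_sub_cancel, sub_zero] at h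
    simpa [Set.indicator_of_mem hx] using h
  · have hx' : max (x - t) 0 = 0 := max_eq_right (sub_nonpos.2 (not_lt.1 hx))
    simp [Set.indicator_of_notMem hx, softStep, hx']

theorem cfc_softStep_apply_of_mem {T : H →L[ℂ] H} {t : ℝ} (n : ℕ) {x : H}
    (hx : x ∈ spectralSubspace T t) : (cfc (softStep t n) T : H →L[ℂ] H) x = 0 := by
  have h : (cfc (softStep t n) T : H →L[ℂ] H) =
      cfc (fun x : ℝ => n / (1 + n * max (x - t) 0)) T * cfc (fun x : ℝ => max (x - t) 0) T := by
    rw [← cfc_mul _ _ T (by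
      refine Continuous.continuousOn ?_
      fun_prop (disch := exact fun x => (one_add_mul_max_pos t n x).ne'))]
    rfl
  have hx' : (cfc (fun x : ℝ => max (x - t) 0) T : H →L[ℂ] H) x = 0 := hx
  rw [h, mul_apply_eq_comp, hx', map_zero]

theorem norm_sub_cfc_softStep_le_one {T : H →L[ℂ] H} (hT : IsSelfAdjoint T) (t : ℝ) (n : ℕ) :
    ‖(1 - cfc (softStep t n) T : H →L[ℂ] H)‖ ≤ 1 := by
  rw [← cfc_const_one ℝ T, ← cfc_sub _ _ T continuousOn_const
    (continuous_softStep t n).continuousOn]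
  refine norm_cfc_le zero_le_one fun x _ => ?_
  rw [Real.norm_of_nonneg (sub_nonneg.2 (softStep_le_one t n x))]
  exact sub_le_self _ (softStep_nonneg t n x)

/-- This is the bound `s / (1 + n s) ≤ 1 / n` for `s = (x - t)₊`. -/
theorem norm_sub_cfc_softStep_mul_le {T : H →L[ℂ] H} (hT : IsSelfAdjoint T) (t : ℝ) (n : ℕ) :
    ‖(1 - cfc (softStep t (n + 1)) T : H →L[ℂ] H) * cfc (fun x : ℝ => max (x - t) 0) T‖ ≤
      1 / ((n : ℝ) + 1) := by
  rw [← cfc_const_one ℝ T, ← cfc_sub _ _ T continuousOn_const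
    (continuous_softStep t _).continuousOn, ← cfc_mul (fun x => 1 - softStep t (n + 1) x) _ T
    (continuousOn_const.sub (continuous_softStep t _).continuousOn)]
  refine norm_cfc_le (by positivity) fun x _ => ?_
  have h := one_add_mul_max_pos t (n + 1) x
  have hm : 0 ≤ max (x - t) 0 := le_max_right _ _
  change ‖(1 - softStep t (n + 1) x) * max (x - t) 0‖ ≤ _
  rw [one_sub_softStep, Real.norm_of_nonneg (by positivity), inv_mul_le_iff₀ h]
  have hn : (0 : ℝ) < (n : ℝ) + 1 := by positivity
  rw [mul_one_div, le_div_iff₀ hn]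
  push_cast
  linarith

/-- The operators obtained from `softStep t n` converge strongly to `1 - χ_(-∞, t](T)`. -/
theorem tendsto_cfc_softStep {T : H →L[ℂ] H} (hT : IsSelfAdjoint T) (t : ℝ) (x : H) :
    Tendsto (fun n : ℕ => (cfc (softStep t (n + 1)) T : H →L[ℂ] H) x) atTop
      (𝓝 (x - spectralProj T t x)) := by
  set y := x - spectralProj T t x with hy
  have hyU : y ∈ (spectralSubspace T t)ᗮ := Submodule.sub_starProjection_mem_orthogonal x
  have hxy : ∀ n : ℕ, (cfc (softStep t (n + 1)) T : H →L[ℂ] H) x =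
      (cfc (softStep t (n + 1)) T : H →L[ℂ] H) y := by
    intro n
    have h : (cfc (softStep t (n + 1)) T : H →L[ℂ] H) (spectralProj T t x) = 0 :=
      cfc_softStep_apply_of_mem (n + 1) (Submodule.starProjection_apply_mem _ x)
    rw [hy, map_sub, h, sub_zero]
  simp only [hxy]
  set S : H →L[ℂ] H := cfc (fun x : ℝ => max (x - t) 0) T with hS
  have hSsa : IsSelfAdjoint S := cfc_predicate _ T
  -- The complement of `ker S` is the closure of the range of `S`, on which `softStep` acts almost
  -- as the identity.
  have hcl : y ∈ closure (Set.range S) := by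
    have h1 : (spectralSubspace T t)ᗮ = S.range.topologicalClosure := by
      have h2 := ContinuousLinearMap.orthogonal_ker S
      rw [hSsa.adjoint_eq] at h2
      exact h2
    rw [h1] at hyU
    exact hyU
  rw [Metric.tendsto_atTop]
  intro ε hε
  obtain ⟨-, ⟨z, rfl⟩, hz⟩ := Metric.mem_closure_iff.1 hcl (ε / 2) (by positivity)
  have hlim : Tendsto (fun n : ℕ => 1 / ((n : ℝ) + 1) * ‖z‖) atTop (𝓝 0) := by
    simpa using tendsto_one_div_add_atTop_nhds_zero_nat.mul_const ‖z‖
  obtain ⟨N, hN⟩ := (eventually_atTop.1 (hlim.eventually_lt_const (half_pos hε)))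
  refine ⟨N, fun n hn => ?_⟩
  set R : H →L[ℂ] H := 1 - cfc (softStep t (n + 1)) T with hR
  have h1 : y - (cfc (softStep t (n + 1)) T : H →L[ℂ] H) y = R (y - S z) + (R * S) z := by
    rw [map_sub R, mul_apply_eq_comp, sub_add_cancel, hR]
    rfl
  rw [dist_comm, dist_eq_norm, h1]
  calc ‖R (y - S z) + (R * S) z‖ ≤ ‖R (y - S z)‖ + ‖(R * S) z‖ := norm_add_le _ _
    _ ≤ 1 * ‖y - S z‖ + 1 / ((n : ℝ) + 1) * ‖z‖ :=
        add_le_add (R.le_of_opNorm_le (norm_sub_cfc_softStep_le_one hT t _) _)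
          ((R * S).le_of_opNorm_le (norm_sub_cfc_softStep_mul_le hT t n) _)
    _ < ε / 2 + ε / 2 := by
        rw [one_mul, ← dist_eq_norm]
        exact add_lt_add hz (hN n hn)
    _ = ε := add_halves ε

end Hilbert

/-! ### The scalar spectral measure of a positive operator -/

section VectorTrace

variable {H : Type*} [NormedAddCommGroup H] [InnerProductSpace ℂ H]

/-- The functional `T ↦ ∑ i, re ⟪b i, T (b i)⟫` given by a finite family of vectors `b`. -/
def vectorTrace {ι : Type*} [Fintype ι] (b : ι → H) : (H →L[ℂ] H) →ₗ[ℝ] ℝ where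
  toFun T := ∑ i, (⟪b i, T (b i)⟫_ℂ).re
  map_add' S T := by
    simp [Finset.sum_add_distrib]
  map_smul' c T := by
    simp only [smul_apply, RingHom.id_apply, smul_eq_mul, Finset.mul_sum]
    refine Finset.sum_congr rfl fun i _ => ?_
    rw [← Complex.coe_smul, inner_smul_right, Complex.re_ofReal_mul]

theorem vectorTrace_mono {ι : Type*} [Fintype ι] (b : ι → H) {S T : H →L[ℂ] H} (h : S ≤ T) :
    vectorTrace b S ≤ vectorTrace b T := by
  refine Finset.sum_le_sum fun i _ => ?_
  have h2 := ((ContinuousLinearMap.le_def _ _).1 h).re_inner_nonneg_right (b i)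
  rw [sub_apply, inner_sub_right, map_sub] at h2
  exact sub_nonneg.1 h2

end VectorTrace

section SpectralMeasure

variable {H : Type*} [NormedAddCommGroup H] [InnerProductSpace ℂ H] [CompleteSpace H]
  {ι : Type*} [Fintype ι] (b : ι → H)

/-- The positive functional `f ↦ vectorTrace b (f(T))` is represented by a measure, by the
Riesz–Markov–Kakutani theorem on the spectrum of `T`. -/
theorem exists_representing_measure {T : H →L[ℂ] H} (hT : IsSelfAdjoint T) :
    ∃ ν : Measure ℝ, IsFiniteMeasure ν ∧ (∀ᵐ x ∂ν, x ∈ spectrum ℝ T) ∧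
      ∀ f : ℝ → ℝ, Continuous f → ∫ x, f x ∂ν = vectorTrace b (cfc f T) := by
  let Λ : CompactlySupportedContinuousMap (spectrum ℝ T) ℝ →ₚ[ℝ] ℝ :=
    { toFun := fun f => vectorTrace b (cfcHom hT f.toContinuousMap)
      map_add' := fun f g => by
        rw [← map_add, ← map_add]
        rfl
      map_smul' := fun c f => by
        rw [RingHom.id_apply, ← map_smul, ← map_smul]
        rfl
      monotone' := fun f g hfg => vectorTrace_mono b (cfcHom_mono hT hfg) }
  have hmeas : Measurable ((↑) : spectrum ℝ T → ℝ) := measurable_subtype_coe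
  refine ⟨(RealRMK.rieszMeasure Λ).map (↑), inferInstance, ?_, fun f hf => ?_⟩
  · have hcl : MeasurableSet (spectrum ℝ T) := (spectrum.isClosed T).measurableSet
    exact (ae_map_iff hmeas.aemeasurable hcl).2 (Eventually.of_forall fun x => x.2)
  · rw [integral_map hmeas.aemeasurable hf.aestronglyMeasurable,
      cfc_apply f T hT hf.continuousOn]
    exact RealRMK.integral_rieszMeasure Λ
      (CompactlySupportedContinuousMap.continuousMapEquiv ⟨fun x => f x, by fun_prop⟩)

/-- The distribution function of the representing measure is found by testing it on `softStep`. -/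
theorem vectorTrace_spectralProj {T : H →L[ℂ] H} (hT : IsSelfAdjoint T)
    {ν : Measure ℝ} [IsFiniteMeasure ν]
    (hν : ∀ f : ℝ → ℝ, Continuous f → ∫ x, f x ∂ν = vectorTrace b (cfc f T)) (t : ℝ) :
    vectorTrace b (spectralProj T t) = ν.real (Set.Iic t) := by
  have h1 : Tendsto (fun n : ℕ => ∫ x, softStep t (n + 1) x ∂ν) atTop
      (𝓝 (∫ x, (Set.Ioi t).indicator 1 x ∂ν)) := by
    refine tendsto_integral_of_dominated_convergence (fun _ => 1)
      (fun n => (continuous_softStep t _).aestronglyMeasurable) (integrable_const 1)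
      (fun n => Eventually.of_forall fun x => ?_) (Eventually.of_forall fun x => ?_)
    · rw [Real.norm_of_nonneg (softStep_nonneg t _ x)]
      exact softStep_le_one t _ x
    · exact (tendsto_softStep t x).comp (tendsto_add_atTop_nat 1)
  have h2 : Tendsto (fun n : ℕ => ∫ x, softStep t (n + 1) x ∂ν) atTop
      (𝓝 (vectorTrace b (1 - spectralProj T t))) := by
    simp only [hν _ (continuous_softStep t _)]
    refine tendsto_finsetSum _ fun i _ => (Complex.continuous_re.tendsto _).comp ?_
    exact tendsto_const_nhds.inner (tendsto_cfc_softStep hT t _)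
  have h3 := tendsto_nhds_unique h1 h2
  rw [integral_indicator_one measurableSet_Ioi, map_sub] at h3
  have h4 : ν.real Set.univ = vectorTrace b 1 := by
    rw [← cfc_const_one ℝ T, ← hν _ continuous_const]
    simp
  have h5 : ν.real (Set.Iic t) + ν.real (Set.Ioi t) = ν.real Set.univ := by
    rw [← Set.compl_Iic, measureReal_add_measureReal_compl measurableSet_Iic]
  linarith

/-- A positive operator has a scalar spectral measure on `[0, ‖T‖]`, determined by its moments,
whose distribution function is given by the spectral projections. -/
theorem exists_scalar_spectral_measure {T : H →L[ℂ] H} (hT : T.IsPositive) :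
    ∃ ν : Measure ℝ, IsFiniteMeasure ν ∧ (∀ᵐ x ∂ν, x ∈ Set.Icc 0 ‖T‖) ∧
      (∀ m : ℕ, ∫ x, x ^ m ∂ν = vectorTrace b (T ^ m)) ∧
      ∀ t, vectorTrace b (spectralProj T t) = ν.real (Set.Iic t) := by
  obtain ⟨ν, hfin, hsupp, hν⟩ := exists_representing_measure b hT.isSelfAdjoint
  have hT0 : 0 ≤ T := (ContinuousLinearMap.nonneg_iff_isPositive T).2 hT
  refine ⟨ν, hfin, hsupp.mono fun x hx => ⟨spectrum_nonneg_of_nonneg hT0 hx, ?_⟩, fun m => ?_,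
    vectorTrace_spectralProj b hT.isSelfAdjoint hν⟩
  · rcases subsingleton_or_nontrivial H with h | h
    · exact absurd hx (by simp)
    · exact (le_abs_self x).trans (spectrum.norm_le_norm_of_mem hx)
  · rw [hν _ (continuous_pow m), cfc_pow_id T m hT.isSelfAdjoint]

end SpectralMeasure

theorem rightLim_measureReal_Iic (ν : Measure ℝ) [IsFiniteMeasure ν] (t : ℝ) :
    Function.rightLim (fun r => ν.real (Set.Iic r)) t = ν.real (Set.Iic t) := by
  refine rightLim_eq_of_tendsto ?_
  have h := tendsto_measure_biInter_gt (μ := ν) (s := fun r : ℝ => Set.Iic r) (a := t)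
    (fun r _ => measurableSet_Iic.nullMeasurableSet)
    (fun i j _ hij => Set.Iic_subset_Iic.2 hij) ⟨t + 1, by simp, measure_ne_top _ _⟩
  have h' : ⋂ r > t, Set.Iic r = Set.Iic t := by
    ext x
    simp only [gt_iff_lt, Set.mem_iInter, Set.mem_Iic]
    exact ⟨fun hx => le_of_forall_gt_imp_ge_of_dense hx, fun hx r hr => hx.trans hr.le⟩
  rw [h'] at h
  exact (ENNReal.tendsto_toReal (measure_ne_top ν _)).comp h

theorem vnTrace_re_eq_vectorTrace {Γ : Type*} [Group Γ] {d : ℕ} (T : L2Vec Γ d →L[ℂ] L2Vec Γ d) :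
    (vnTrace T).re = vectorTrace (fun i : Fin d => basisVec Γ i) T :=
  Complex.re_sum _ _

/-- The Lebesgue–Stieltjes measure of the spectral density function of a positive operator `T` is
finite, is carried by `[0, ‖T‖]`, and has the traces of the powers of `T` as moments. -/
theorem spectralMeasure_spec {Γ : Type*} [Group Γ] {d : ℕ} {T : L2Vec Γ d →L[ℂ] L2Vec Γ d}
    (hT : T.IsPositive) :
    IsFiniteMeasure (spectralMeasure T) ∧ (∀ᵐ x ∂(spectralMeasure T), x ∈ Set.Icc 0 ‖T‖) ∧
      ∀ m : ℕ, ∫ x, x ^ m ∂(spectralMeasure T) = (vnTrace (T ^ m)).re := by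
  obtain ⟨ν, hfin, hsupp, hmom, hF⟩ :=
    exists_scalar_spectral_measure (fun i : Fin d => basisVec Γ i) hT
  have hF' : spectralDensity T = fun t => ν.real (Set.Iic t) := by
    ext t
    rw [← hF t]
    exact vnTrace_re_eq_vectorTrace _
  have hright : ∀ t, Function.rightLim (spectralDensity T) t = ν.real (Set.Iic t) := by
    intro t
    rw [hF', rightLim_measureReal_Iic]
  have heq : spectralMeasure T = ν := by
    refine (Measure.ext_of_Ioc _ _ fun a b hab => ?_).symm
    rw [spectralMeasure, StieltjesFunction.measure_Ioc, Monotone.stieltjesFunction_eq,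
      Monotone.stieltjesFunction_eq, hright, hright,
      ← measureReal_sdiff (Set.Iic_subset_Iic.2 hab.le) measurableSet_Iic, Set.Iic_sdiff_Iic,
      ofReal_measureReal]
  rw [heq]
  exact ⟨hfin, hsupp, fun m => by rw [hmom, vnTrace_re_eq_vectorTrace]⟩

/-! ### Polynomial test functions -/

/-- The sofic approximation transfers the positivity of traces of integer matrices to the von
Neumann trace: a polynomial that dominates `log` on `[0, K]` has nonnegative trace at `T²`. -/
theorem sum_vnTrace_nonneg {Γ : Type*} [Group Γ] (hΓ : IsSofic Γ) {d : ℕ}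
    (A : Matrix (Fin d) (Fin d) (MonoidAlgebra ℤ Γ)) (hA : IsSelfAdjoint (matrixOp A)) {K : ℝ}
    (hK : ((∑ i, ∑ j, ∑ w ∈ (wordGram A i j).coeff.support,
      |(wordGram A i j).coeff w| : ℤ) : ℝ) ≤ K)
    (p : Polynomial ℝ) (hp : ∀ x ∈ Set.Icc 0 K, Real.log x ≤ p.eval x) :
    0 ≤ p.sum fun m c => c * (vnTrace (matrixOp A ^ (2 * m))).re := by
  classical
  set Y := wordGram A with hY
  set L : ℝ := ∑ m ∈ p.support, |p.coeff m| *
    ∑ i, ∑ w ∈ ((Y ^ m) i i).coeff.support, |(((Y ^ m) i i).coeff w : ℝ)| with hL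
  have hL0 : 0 ≤ L := Finset.sum_nonneg fun m _ => mul_nonneg (abs_nonneg _)
    (Finset.sum_nonneg fun i _ => Finset.sum_nonneg fun w _ => abs_nonneg _)
  refine le_of_forall_pos_le_add fun ε hε => ?_
  set η : ℝ := ε / (L + 1) with hη
  have hη0 : 0 < η := by positivity
  have hηL : η * L ≤ ε := by
    have h : η * (L + 1) = ε := div_mul_cancel₀ _ (by positivity)
    nlinarith
  obtain ⟨n, hn, ψ, hψ⟩ := hΓ.exists_perm_hom (p.support.biUnion fun m =>
    Finset.univ.biUnion fun i => ((Y ^ m) i i).coeff.support) hη0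
  have hn0 : (0 : ℝ) < n := by exact_mod_cast hn
  have hgram : blockRep ψ d Y =
      (blockRep ψ d (wordLift A)).transpose * blockRep ψ d (wordLift A) := by
    rw [← blockRep_starMatrix, ← map_mul]
    rfl
  have hfin : 0 ≤ p.sum fun m c => c * ((blockRep ψ d (Y ^ m)).trace : ℝ) := by
    have h := sum_trace_gram_nonneg (blockRep ψ d (wordLift A)) (K := K) (fun i => ?_) p hp
    · rw [← hgram] at h
      simpa only [map_pow] using h
    · rw [← hgram]
      refine le_trans ?_ hK
      exact_mod_cast sum_abs_blockRep_le ψ Y i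
  have hdiff : ∀ m ∈ p.support, |((blockRep ψ d (Y ^ m)).trace : ℝ) -
      n * (vnTrace (matrixOp A ^ (2 * m))).re| ≤
        (∑ i, ∑ w ∈ ((Y ^ m) i i).coeff.support, |(((Y ^ m) i i).coeff w : ℝ)|) * (η * n) := by
    intro m hm
    have h : ((blockRep ψ d (Y ^ m)).trace : ℝ) - n * (vnTrace (matrixOp A ^ (2 * m))).re =
        ∑ i, ∑ w ∈ ((Y ^ m) i i).coeff.support, (((Y ^ m) i i).coeff w : ℝ) *
          ((fixCard (ψ w) : ℝ) - if wordProj Γ w = 1 then (n : ℝ) else 0) := by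
      rw [trace_blockRep, vnTrace_matrixOp_pow A hA, Complex.intCast_re, ← hY]
      simp only [Finsupp.sum, Int.cast_sum, Finset.mul_sum]
      rw [← Finset.sum_sub_distrib]
      refine Finset.sum_congr rfl fun i _ => ?_
      rw [← Finset.sum_sub_distrib]
      refine Finset.sum_congr rfl fun w _ => ?_
      split_ifs <;> push_cast <;> ring
    rw [h, Finset.sum_mul]
    refine (Finset.abs_sum_le_sum_abs _ _).trans (Finset.sum_le_sum fun i _ => ?_)
    rw [Finset.sum_mul]
    refine (Finset.abs_sum_le_sum_abs _ _).trans (Finset.sum_le_sum fun w hw => ?_)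
    rw [abs_mul]
    exact mul_le_mul_of_nonneg_left (hψ w (Finset.mem_biUnion.2 ⟨m, hm,
      Finset.mem_biUnion.2 ⟨i, Finset.mem_univ i, hw⟩⟩)) (abs_nonneg _)
  have hsum : (p.sum fun m c => c * ((blockRep ψ d (Y ^ m)).trace : ℝ)) ≤
      n * (p.sum fun m c => c * (vnTrace (matrixOp A ^ (2 * m))).re) + L * (η * n) := by
    rw [Polynomial.sum_def, Polynomial.sum_def, Finset.mul_sum, hL, Finset.sum_mul,
      ← Finset.sum_add_distrib]
    refine Finset.sum_le_sum fun m hm => ?_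
    have h1 := mul_le_mul_of_nonneg_left (hdiff m hm) (abs_nonneg (p.coeff m))
    rw [← abs_mul] at h1
    have h2 := (le_abs_self _).trans h1
    linarith
  have h : 0 ≤ n * ((p.sum fun m c => c * (vnTrace (matrixOp A ^ (2 * m))).re) + ε) := by
    nlinarith [mul_le_mul_of_nonneg_left hηL hn0.le]
  exact nonneg_of_mul_nonneg_right h hn0

/-! ### From polynomials to the logarithm -/

/-- By the Weierstrass theorem, polynomials may be replaced by continuous functions. -/
theorem integral_nonneg_of_polynomial {ρ : Measure ℝ} [IsFiniteMeasure ρ] {K : ℝ}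
    (hρ : ∀ᵐ x ∂ρ, x ∈ Set.Icc 0 K)
    (hpoly : ∀ p : Polynomial ℝ, (∀ x ∈ Set.Icc 0 K, Real.log x ≤ p.eval x) →
      0 ≤ ∫ x, p.eval x ∂ρ)
    {f : ℝ → ℝ} (hf : Continuous f) (hlog : ∀ x ∈ Set.Icc 0 K, Real.log x ≤ f x) :
    Integrable f ρ ∧ 0 ≤ ∫ x, f x ∂ρ := by
  have hint : ∀ g : ℝ → ℝ, Continuous g → Integrable g ρ := by
    intro g hg
    obtain ⟨C, hC⟩ := isCompact_Icc.exists_bound_of_continuousOn (hg.continuousOn (s := Set.Icc 0 K))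
    exact Integrable.of_bound hg.aestronglyMeasurable C (hρ.mono hC)
  refine ⟨hint f hf, le_of_forall_pos_le_add fun ε hε => ?_⟩
  set δ : ℝ := ε / (2 * (ρ.real Set.univ + 1)) with hδ
  have hu : 0 ≤ ρ.real Set.univ := measureReal_nonneg
  have hδ0 : 0 < δ := by positivity
  obtain ⟨p, hp⟩ := exists_polynomial_near_of_continuousOn 0 K f hf.continuousOn δ hδ0
  have h1 : 0 ≤ ∫ x, (p + Polynomial.C δ).eval x ∂ρ := by
    refine hpoly _ fun x hx => ?_
    have := (abs_lt.1 (hp x hx)).1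
    rw [Polynomial.eval_add, Polynomial.eval_C]
    linarith [hlog x hx]
  have h2 : ∫ x, (p + Polynomial.C δ).eval x ∂ρ ≤ ∫ x, (f x + 2 * δ) ∂ρ := by
    refine integral_mono_ae (hint _ (Polynomial.continuous _)) (hint _ (by fun_prop))
      (hρ.mono fun x hx => ?_)
    have := (abs_lt.1 (hp x hx)).2
    change (p + Polynomial.C δ).eval x ≤ f x + 2 * δ
    rw [Polynomial.eval_add, Polynomial.eval_C]
    linarith
  rw [integral_add (hint f hf) (integrable_const _), integral_const, smul_eq_mul] at h2
  have h3 : ρ.real Set.univ * (2 * δ) ≤ ε := by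
    have h : δ * (2 * (ρ.real Set.univ + 1)) = ε := div_mul_cancel₀ _ (by positivity)
    nlinarith
  linarith

/-- Continuous functions that dominate `Real.log` on `[0, ∞)` and converge to it pointwise. At `0`,
where `Real.log 0 = 0`, the second summand compensates for the truncation of the logarithm. -/
def logApprox (n : ℕ) (x : ℝ) : ℝ :=
  Real.log (max x ((n : ℝ) + 1)⁻¹) + Real.log ((n : ℝ) + 1) * max (1 - ((n : ℝ) + 1) * x) 0

theorem continuous_logApprox (n : ℕ) : Continuous (logApprox n) := by
  have h : ∀ x : ℝ, max x ((n : ℝ) + 1)⁻¹ ≠ 0 := fun x =>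
    (lt_max_of_lt_right (by positivity)).ne'
  unfold logApprox
  fun_prop (disch := exact h)

theorem logApprox_of_le {n : ℕ} {x : ℝ} (hx : x ≤ ((n : ℝ) + 1)⁻¹) :
    logApprox n x = -(Real.log ((n : ℝ) + 1) * (((n : ℝ) + 1) * x)) := by
  have hn : (0 : ℝ) < (n : ℝ) + 1 := by positivity
  have h : ((n : ℝ) + 1) * x ≤ 1 := by
    have := mul_le_mul_of_nonneg_left hx hn.le
    rwa [mul_inv_cancel₀ hn.ne'] at this
  rw [logApprox, max_eq_right hx, max_eq_left (by linarith), Real.log_inv]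
  ring

theorem logApprox_of_ge {n : ℕ} {x : ℝ} (hx : ((n : ℝ) + 1)⁻¹ ≤ x) :
    logApprox n x = Real.log x := by
  have hn : (0 : ℝ) < (n : ℝ) + 1 := by positivity
  have h : 1 ≤ ((n : ℝ) + 1) * x := by
    have := mul_le_mul_of_nonneg_left hx hn.le
    rwa [mul_inv_cancel₀ hn.ne'] at this
  rw [logApprox, max_eq_left hx, max_eq_right (by linarith), mul_zero, add_zero]

theorem log_natCast_add_one_nonneg (n : ℕ) : 0 ≤ Real.log ((n : ℝ) + 1) :=
  Real.log_nonneg (by linarith [n.cast_nonneg (α := ℝ)])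

theorem log_le_logApprox {n : ℕ} {x : ℝ} (hx : 0 ≤ x) : Real.log x ≤ logApprox n x := by
  rcases hx.eq_or_lt with rfl | hx
  · rw [logApprox_of_le (by positivity)]
    simp
  · have h1 : Real.log x ≤ Real.log (max x ((n : ℝ) + 1)⁻¹) :=
      Real.log_le_log hx (le_max_left _ _)
    have h2 := mul_nonneg (log_natCast_add_one_nonneg n)
      (le_max_right (1 - ((n : ℝ) + 1) * x) 0)
    unfold logApprox
    linarith

theorem logApprox_le {n : ℕ} {x K : ℝ} (hx : x ∈ Set.Icc 0 K) :
    logApprox n x ≤ Real.log (max K 1) := by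
  have hK : 0 ≤ Real.log (max K 1) := Real.log_nonneg (le_max_right _ _)
  rcases le_total x ((n : ℝ) + 1)⁻¹ with h | h
  · rw [logApprox_of_le h]
    have := mul_nonneg (log_natCast_add_one_nonneg n)
      (mul_nonneg (by positivity : (0 : ℝ) ≤ (n : ℝ) + 1) hx.1)
    linarith
  · rw [logApprox_of_ge h]
    exact Real.log_le_log (lt_of_lt_of_le (by positivity) h) (hx.2.trans (le_max_left _ _))

theorem tendsto_logApprox {x : ℝ} (hx : 0 ≤ x) :
    Tendsto (fun n => logApprox n x) atTop (𝓝 (Real.log x)) := by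
  rcases hx.eq_or_lt with rfl | hx
  · have h : ∀ n : ℕ, logApprox n 0 = Real.log 0 := fun n => by
      rw [logApprox_of_le (by positivity)]
      simp
    simp only [h, tendsto_const_nhds]
  · refine tendsto_const_nhds.congr' ?_
    have h := tendsto_one_div_add_atTop_nhds_zero_nat (𝕜 := ℝ)
    filter_upwards [h.eventually_lt_const hx] with n hn
    rw [one_div] at hn
    exact (logApprox_of_ge hn.le).symm

/-- The Fatou argument: if every polynomial that dominates the logarithm has nonnegative integral,
then the logarithm is integrable, with nonnegative integral. -/
theorem integrable_log_of_polynomial {ρ : Measure ℝ} [IsFiniteMeasure ρ] {K : ℝ}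
    (hρ : ∀ᵐ x ∂ρ, x ∈ Set.Icc 0 K)
    (hpoly : ∀ p : Polynomial ℝ, (∀ x ∈ Set.Icc 0 K, Real.log x ≤ p.eval x) →
      0 ≤ ∫ x, p.eval x ∂ρ) :
    Integrable Real.log ρ ∧ 0 ≤ ∫ x, Real.log x ∂ρ := by
  set M : ℝ := Real.log (max K 1) with hM
  have hM0 : 0 ≤ M := Real.log_nonneg (le_max_right _ _)
  have happrox : ∀ n, Integrable (logApprox n) ρ ∧ 0 ≤ ∫ x, logApprox n x ∂ρ := fun n =>
    integral_nonneg_of_polynomial hρ hpoly (continuous_logApprox n) fun x hx =>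
      log_le_logApprox hx.1
  have hbound : ∀ n, ∫⁻ x, ENNReal.ofReal (M - logApprox n x) ∂ρ ≤
      ENNReal.ofReal (M * ρ.real Set.univ) := by
    intro n
    have hsub : Integrable (fun x => M - logApprox n x) ρ :=
      (integrable_const M).sub (happrox n).1
    rw [← ofReal_integral_eq_lintegral_ofReal hsub
      (hρ.mono fun x hx => sub_nonneg.2 (logApprox_le hx))]
    refine ENNReal.ofReal_le_ofReal ?_
    rw [integral_sub (integrable_const M) (happrox n).1, integral_const, smul_eq_mul, mul_comm]
    exact sub_le_self _ (happrox n).2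
  have hlim : ∫⁻ x, ENNReal.ofReal (M - Real.log x) ∂ρ ≤ ENNReal.ofReal (M * ρ.real Set.univ) := by
    calc ∫⁻ x, ENNReal.ofReal (M - Real.log x) ∂ρ
        = ∫⁻ x, liminf (fun n => ENNReal.ofReal (M - logApprox n x)) atTop ∂ρ := by
          refine lintegral_congr_ae (hρ.mono fun x hx => ?_)
          exact (ENNReal.tendsto_ofReal
            (tendsto_const_nhds.sub (tendsto_logApprox hx.1))).liminf_eq.symm
      _ ≤ liminf (fun n => ∫⁻ x, ENNReal.ofReal (M - logApprox n x) ∂ρ) atTop :=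
          lintegral_liminf_le fun n =>
            (measurable_const.sub (continuous_logApprox n).measurable).ennreal_ofReal
      _ ≤ ENNReal.ofReal (M * ρ.real Set.univ) :=
          liminf_le_of_le (by isBoundedDefault) fun b hb => by
            obtain ⟨n, hn⟩ := hb.exists
            exact hn.trans (hbound n)
  have hnonneg : 0 ≤ᵐ[ρ] fun x => M - Real.log x :=
    hρ.mono fun x hx => sub_nonneg.2 ((log_le_logApprox (n := 0) hx.1).trans (logApprox_le hx))
  have hmeas : AEStronglyMeasurable (fun x => M - Real.log x) ρ :=
    (measurable_const.sub Real.measurable_log).aestronglyMeasurable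
  have hsub : Integrable (fun x => M - Real.log x) ρ :=
    ⟨hmeas, (hasFiniteIntegral_iff_ofReal hnonneg).2 (hlim.trans_lt ENNReal.ofReal_lt_top)⟩
  have hint : Integrable Real.log ρ := by
    refine ((integrable_const M).sub hsub).congr (Eventually.of_forall fun x => ?_)
    exact sub_sub_cancel M (Real.log x)
  refine ⟨hint, ?_⟩
  have h1 : ∫ x, (M - Real.log x) ∂ρ ≤ M * ρ.real Set.univ := by
    rw [integral_eq_lintegral_of_nonneg_ae hnonneg hmeas]
    exact ENNReal.toReal_le_of_le_ofReal (by positivity) hlim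
  rw [integral_sub (integrable_const M) hint, integral_const, smul_eq_mul, mul_comm] at h1
  linarith

theorem lnDet_matrixOp_nonneg {Γ : Type*} [Group Γ] (hΓ : IsSofic Γ) (d : ℕ)
    (Δ : Matrix (Fin d) (Fin d) (MonoidAlgebra ℤ Γ)) (hΔ : (matrixOp Δ).IsPositive) :
    0 ≤ lnDet (matrixOp Δ) := by
  obtain ⟨hfin, hsupp, hmom⟩ := spectralMeasure_spec hΔ
  set μ := spectralMeasure (matrixOp Δ) with hμ
  set M := ‖matrixOp Δ‖ with hM
  set K : ℝ := max (((∑ i, ∑ j, ∑ w ∈ (wordGram Δ i j).coeff.support,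
    |(wordGram Δ i j).coeff w| : ℤ) : ℝ)) (M ^ 2) with hK
  have hsq : Measurable fun x : ℝ => x ^ 2 := by fun_prop
  have hpow : ∀ m : ℕ, Integrable (fun x : ℝ => (x ^ 2) ^ m) μ := fun m =>
    Integrable.of_bound (by fun_prop) ((M ^ 2) ^ m) (hsupp.mono fun x hx => by
      rw [Real.norm_of_nonneg (by positivity)]
      have := hx.1
      gcongr
      exact hx.2)
  -- The approximating matrices see only `T²`, so the argument is applied to the image of the
  -- spectral measure under squaring; `log (x ^ 2) = 2 * log x` leads back to `T`.
  have key := integrable_log_of_polynomial (ρ := μ.map fun x => x ^ 2) (K := K)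
    ((ae_map_iff hsq.aemeasurable measurableSet_Icc).2 (hsupp.mono fun x hx =>
      ⟨sq_nonneg x, (pow_le_pow_left₀ hx.1 hx.2 2).trans (le_max_right _ _)⟩)) fun p hp => by
    rw [integral_map hsq.aemeasurable p.continuous.aestronglyMeasurable]
    have h := sum_vnTrace_nonneg hΓ Δ hΔ.isSelfAdjoint (le_max_left _ _) p hp
    simp only [Polynomial.eval_eq_sum, Polynomial.sum_def] at h ⊢
    rw [integral_finsetSum _ fun m _ => (hpow m).const_mul _]
    simpa only [integral_const_mul, ← pow_mul, hmom] using h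
  rw [integrable_map_measure Real.measurable_log.aestronglyMeasurable hsq.aemeasurable,
    integral_map hsq.aemeasurable Real.measurable_log.aestronglyMeasurable] at key
  simp only [Function.comp_def, Real.log_pow, Nat.cast_ofNat, integral_const_mul] at key
  have hint : Integrable Real.log μ := by
    simpa using key.1.const_mul (1 / 2 : ℝ)
  have hset : ∫ x in Set.Ioi 0, Real.log x ∂μ = ∫ x, Real.log x ∂μ :=
    setIntegral_eq_integral_of_ae_compl_eq_zero (hsupp.mono fun x hx hx' => by
      rw [le_antisymm (not_lt.1 hx') hx.1, Real.log_zero])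
  rw [lnDet, if_pos hint.integrableOn, ← hμ, hset]
  exact EReal.coe_nonneg.2 (by linarith [key.2])

end SoficDet

end

theorem theorem6p5 {Γ : Type*} [Group Γ] (hΓ : SoficDet.IsSofic Γ) (d : ℕ)
    (Δ : Matrix (Fin d) (Fin d) (MonoidAlgebra ℤ Γ))
    (hΔ : (SoficDet.matrixOp Δ).IsPositive) :
    0 ≤ SoficDet.lnDet (SoficDet.matrixOp Δ) :=
  SoficDet.lnDet_matrixOp_nonneg hΓ d Δ hΔ
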